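/- Let $p$ be a prime, $q=p^\alpha$, and let $H$ be a subgroup of $(\mathbb F_q,+)$ with $|H|=p^\beta$. Let $\mathrm{AGL}(1,\mathbb F_q)=\{\left[\begin{smallmatrix}a&b\\0&1\end{smallmatrix}\right]:a\in\mathbb F_q^*,\ b\in\mathbb F_q\}$ act on $\mathbb F_q$ by $x\mapsto ax+b$, and let $S(1,0,H)=\{\left[\begin{smallmatrix}1&h\\0&1\end{smallmatrix}\right]:h\in H\}$ be the group of translations by elements of $H$. For a subgroup $S$ of $\mathrm{AGL}(1,\mathbb F_q)$ and $0\le k\le q$, let $\mathcal N(S,k)$ be the number of $k$-element subsets $B$ of $\mathbb F_q$ whose setwise stabilizer in $\mathrm{AGL}(1,\mathbb F_q)$ is exactly $S$. Let $H'=\{x\in\mathbb F_q: xH\subset H\}$, which is a subfield of $\mathbb F_q$. For a positive integer $u$ let $\mathcal P(u)$ be the set of prime divisors of $u$, and for $v$ coprime to $u$ let $o_u(v)$ be the multiplicative order of $v$ modulo $u$ (so $o_1(v)=1$). For a finite set $P$ of integers let $\Pi P=\prod_{e\in P}e$ (so $\Pi\emptyset=1$). Let ${n\brack m}_r=\prod_{i=0}^{m-1}\frac{1-r^{n-i}}{1-r^{i+1}}$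 be the Gaussian binomial coefficient, and for integers $u,v>0$ let $$s_{q,k}(u,v)=\binom{(q-v)/uv}{k/uv}+\binom{(q-v)/uv}{(k-v)/uv},$$ where a binomial coefficient $\binom xy$ is $0$ if $y$ is not a nonnegative integer. Then for every $0\le k\le q$, $$\begin{aligned}\mathcal N(S(1,0,H),k)={}&(1-p^{\alpha-\beta})\sum_{0\le l\le\alpha-\beta}(-1)^l\,p^{\binom l2}{\alpha-\beta\brack l}_p\,s_{q,k}(1,p^{\beta+l})\\&+p^{\alpha-\beta}\sum_{P\subset\mathcal P(|H'|-1)}\ \sum_{0\le l\le(\alpha-\beta)/o_{\Pi P}(p)}(-1)^{|P|+l}\,p^{o_{\Pi P}(p)\binom l2}{(\alpha-\beta)/o_{\Pi P}(p)\brack l}_{p^{o_{\Pi P}(p)}}\,s_{q,k}\bigl(\Pi P,\,p^{\beta+l\,o_{\Pi P}(p)}\bigr).\end{aligned}$$ -/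

import Mathlib

open scoped Pointwise

/-- The affine linear group `AGL(1, F)`: all invertible matrices `!![a, b; 0, 1]`. -/
def AGL1 (F : Type*) [Field F] : Subgroup (GL (Fin 2) F) where
  carrier := {g | ∃ a b : F, a ≠ 0 ∧ (g : Matrix (Fin 2) (Fin 2) F) = !![a, b; 0, 1]}
  mul_mem' := by
    rintro g h ⟨a, b, ha, hg⟩ ⟨c, d, hc, hh⟩
    refine ⟨a * c, a * d + b, mul_ne_zero ha hc, ?_⟩
    rw [Units.val_mul, hg, hh]
    simp [Matrix.mul_fin_two]
  one_mem' := ⟨1, 0, one_ne_zero, by simp [Matrix.one_fin_two]⟩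
  inv_mem' := by
    rintro g ⟨a, b, ha, hg⟩
    refine ⟨a⁻¹, -(a⁻¹ * b), inv_ne_zero ha, ?_⟩
    refine Units.inv_eq_of_mul_eq_one_right ?_
    rw [hg]
    simp [Matrix.mul_fin_two, Matrix.one_fin_two, ha]

/-- The matrix `!![a, b; 0, 1]` as an element of `AGL(1, F)`. -/
def AGL1.mk {F : Type*} [Field F] (a : Fˣ) (b : F) : AGL1 F :=
  ⟨Matrix.GeneralLinearGroup.mkOfDetNeZero !![(a : F), b; 0, 1] (by simp),
    a, b, a.ne_zero, rfl⟩

/-- The action of `AGL(1, F)` on `F`: the matrix `!![a, b; 0, 1]` sends `x` to `a * x + b`. -/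
instance AGL1.mulAction (F : Type*) [Field F] : MulAction (AGL1 F) F where
  smul g x := g.1.1 0 0 * x + g.1.1 0 1
  one_smul x := by
    change (1 : Matrix (Fin 2) (Fin 2) F) 0 0 * x + (1 : Matrix (Fin 2) (Fin 2) F) 0 1 = x
    simp
  mul_smul := by
    rintro ⟨g, a, b, ha, hg⟩ ⟨h, c, d, hc, hh⟩ x
    change (g.1 * h.1) 0 0 * x + (g.1 * h.1) 0 1 =
      g.1 0 0 * (h.1 0 0 * x + h.1 0 1) + g.1 0 1
    rw [hg, hh]
    simp [Matrix.mul_fin_two]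
    ring

/-- `S(a, b, H)`: the subgroup of `AGL(1, F)` generated by `!![a, b; 0, 1]` and by the translations
`!![1, h; 0, 1]` with `h ∈ H`. -/
def AGL1.S {F : Type*} [Field F] (a : Fˣ) (b : F) (H : AddSubgroup F) : Subgroup (AGL1 F) :=
  Subgroup.closure ({AGL1.mk a b} ∪ {g | ∃ h ∈ H, g = AGL1.mk 1 h})

/-- `𝒩(S, k)`: the number of `k`-element subsets `B` of `F` whose (setwise) stabilizer in
`AGL(1, F)` is exactly `S`. -/
noncomputable def stabCount {F : Type*} [Field F] (S : Subgroup (AGL1 F)) (k : ℕ) : ℕ :=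
  Nat.card {B : Set F // B.ncard = k ∧ MulAction.stabilizer (AGL1 F) B = S}

/-- `H' = {x : x H ⊆ H}`. -/
def multiplierSet {F : Type*} [Field F] (H : AddSubgroup F) : Set F :=
  {x | ∀ h ∈ H, x * h ∈ H}

/-- The binomial coefficient `x choose y`, set to be `0` when `y` is not a natural number. -/
noncomputable def ratBinom (x y : ℚ) : ℚ :=
  if y = (⌊y⌋₊ : ℚ) then Ring.choose x ⌊y⌋₊ else 0

/-- `s_{q,k}(u,v)`; all divisions are divisions of rational numbers. -/
noncomputable def orbitCount (q k u v : ℕ) : ℚ :=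
  ratBinom (((q : ℚ) - v) / (u * v)) ((k : ℚ) / (u * v)) +
    ratBinom (((q : ℚ) - v) / (u * v)) (((k : ℚ) - v) / (u * v))

/-- The Gaussian binomial coefficient `[n, m]_q`, for a natural number `q ≥ 2`. For `m > n` the
factor with `i = n` is `0`. -/
def gaussBinom (q n m : ℕ) : ℚ :=
  ∏ i ∈ Finset.range m, (1 - (q : ℚ) ^ (n - i)) / (1 - (q : ℚ) ^ (i + 1))

/-- `o_u(v)`: the multiplicative order of `v` modulo `u` (equal to `1` for `u = 1`). -/
noncomputable def multOrd (u v : ℕ) : ℕ := orderOf (v : ZMod u)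

/-! ### Gaussian binomial coefficients and subspaces over a finite field -/

/-! The stabilizer of `B` is `S(1,0,H)` exactly when the translations preserving `B` form `H` and
the group `A` of linear parts is trivial. Linear parts multiply `H` into itself, so `A` is a
subgroup of the cyclic group `Fˣ` of order dividing `|H'| - 1`. Inclusion–exclusion over sets `P` of
primes reduces the count to sets with `A` containing the `u`-th roots of unity, `u = ΠP`
(`stabCount_eq_sum_powerset`).

For `u ≠ 1` an affine map with linear part `ζ ≠ 1` has a fixed point, so `B` is a translate of a set
preserved by `ζ` itself, with centre unique modulo `H`. This gives a factor `p^(α-β)`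
(`card_unityRoots_le_linearParts`). For `u = 1` the factor is absent, whence the separate term with
`1 - p^(α-β)`.

It remains to count sets preserved by the `u`-th roots of unity with translation group exactly `H`
(`card_transStab_eq`). Such translation groups are vector spaces over `E`, the field generated by
these roots, of order `p^(o_u(p))`. Möbius inversion over the `E`-subspaces above `H` yields the
Gaussian binomials. Sets invariant under the roots and under translation by `W` are unions of
orbits: `W`, and orbits of size `u|W|`; hence `s_{q,k}(u,|W|)` (`card_invariant_set_eq_orbitCount`).
-/

theorem gaussBinom_zero_right (Q n : ℕ) : gaussBinom Q n 0 = 1 := by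
  simp [gaussBinom]

theorem gaussBinom_succ_right (Q n l : ℕ) :
    gaussBinom Q n (l + 1) =
      gaussBinom Q n l * ((1 - (Q : ℚ) ^ (n - l)) / (1 - (Q : ℚ) ^ (l + 1))) := by
  rw [gaussBinom, Finset.prod_range_succ, gaussBinom]

theorem gaussBinom_eq_zero (Q : ℕ) {n l : ℕ} (h : n < l) : gaussBinom Q n l = 0 :=
  Finset.prod_eq_zero (Finset.mem_range.2 h) (by simp)

theorem one_sub_pow_ne_zero {Q : ℕ} (hQ : 2 ≤ Q) (l : ℕ) : (1 : ℚ) - (Q : ℚ) ^ (l + 1) ≠ 0 := by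
  have : (1 : ℚ) < (Q : ℚ) ^ (l + 1) := one_lt_pow₀ (by exact_mod_cast hQ) (by omega)
  linarith

theorem gaussBinom_succ_succ_eq_mul (Q n l : ℕ) :
    gaussBinom Q (n + 1) (l + 1) =
      gaussBinom Q n l * ((1 - (Q : ℚ) ^ (n + 1)) / (1 - (Q : ℚ) ^ (l + 1))) := by
  rw [gaussBinom, gaussBinom, Finset.prod_div_distrib, Finset.prod_div_distrib,
    Finset.prod_range_succ', Finset.prod_range_succ (fun i => 1 - (Q : ℚ) ^ (i + 1))]
  simp only [Nat.add_sub_add_right, Nat.sub_zero]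
  rw [mul_div_mul_comm]

theorem gaussBinom_pascal {Q : ℕ} (hQ : 2 ≤ Q) (n l : ℕ) :
    gaussBinom Q (n + 1) (l + 1) = (Q : ℚ) ^ (l + 1) * gaussBinom Q n (l + 1) +
      gaussBinom Q n l := by
  rcases lt_or_ge n l with h | h
  · rw [gaussBinom_eq_zero Q h, gaussBinom_eq_zero Q (show n < l + 1 by omega),
      gaussBinom_eq_zero Q (show n + 1 < l + 1 by omega)]
    simp
  · rw [gaussBinom_succ_succ_eq_mul, gaussBinom_succ_right]
    have h0 := one_sub_pow_ne_zero hQ l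
    obtain ⟨m, rfl⟩ := Nat.exists_eq_add_of_le h
    rw [Nat.add_sub_cancel_left]
    field_simp
    ring

/-- The sum telescopes by Pascal's rule. At `m = n + 1` the closed form vanishes, which gives the
full alternating sum below. -/
theorem sum_neg_one_pow_gaussBinom_partial {Q : ℕ} (hQ : 2 ≤ Q) (n m : ℕ) :
    ∑ l ∈ Finset.range (m + 1),
      (-1 : ℚ) ^ l * (Q : ℚ) ^ (l.choose 2) * gaussBinom Q (n + 1) l =
      (-1) ^ m * (Q : ℚ) ^ ((m + 1).choose 2) * gaussBinom Q n m := by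
  induction m with
  | zero => simp [gaussBinom_zero_right]
  | succ m ih =>
    rw [Finset.sum_range_succ, ih, gaussBinom_pascal hQ,
      Nat.choose_succ_succ' (m + 1) 1, Nat.choose_one_right]
    ring

theorem sum_neg_one_pow_gaussBinom {Q : ℕ} (hQ : 2 ≤ Q) (n : ℕ) :
    ∑ l ∈ Finset.range (n + 1), (-1 : ℚ) ^ l * (Q : ℚ) ^ (l.choose 2) * gaussBinom Q n l =
      if n = 0 then 1 else 0 := by
  cases n with
  | zero => simp [gaussBinom_zero_right]
  | succ n =>
    rw [sum_neg_one_pow_gaussBinom_partial hQ, gaussBinom_eq_zero Q (Nat.lt_succ_self n)]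
    simp

theorem prod_pow_sub_pow_eq_gaussBinom_mul {Q : ℕ} (hQ : 2 ≤ Q) {n l : ℕ} (hl : l ≤ n) :
    ∏ i ∈ Finset.range l, ((Q : ℚ) ^ n - (Q : ℚ) ^ i) =
      gaussBinom Q n l * ∏ i ∈ Finset.range l, ((Q : ℚ) ^ l - (Q : ℚ) ^ i) := by
  have key : ∀ N, l ≤ N → ∏ i ∈ Finset.range l, ((Q : ℚ) ^ N - (Q : ℚ) ^ i) =
      (∏ i ∈ Finset.range l, (-(Q : ℚ) ^ i)) *
        ∏ i ∈ Finset.range l, (1 - (Q : ℚ) ^ (N - i)) := by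
    intro N hN
    rw [← Finset.prod_mul_distrib]
    refine Finset.prod_congr rfl fun i hi => ?_
    have hi := Finset.mem_range.1 hi
    have : (Q : ℚ) ^ N = (Q : ℚ) ^ i * (Q : ℚ) ^ (N - i) := by rw [← pow_add]; congr 1; omega
    rw [this]; ring
  have hrefl : ∏ i ∈ Finset.range l, (1 - (Q : ℚ) ^ (l - i)) =
      ∏ i ∈ Finset.range l, (1 - (Q : ℚ) ^ (i + 1)) := by
    rw [← Finset.prod_range_reflect]
    refine Finset.prod_congr rfl fun i hi => ?_
    have hi := Finset.mem_range.1 hi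
    congr 2; omega
  rw [key n hl, key l le_rfl, hrefl, gaussBinom, Finset.prod_div_distrib]
  have : ∏ i ∈ Finset.range l, (1 - (Q : ℚ) ^ (i + 1)) ≠ 0 :=
    Finset.prod_ne_zero_iff.2 fun i _ => one_sub_pow_ne_zero hQ i
  field_simp

section Subspaces

variable {E V : Type*} [Field E] [Finite E] [AddCommGroup V] [Module E V] [Finite V]

open Module

theorem card_linearIndependent_rat {l : ℕ} (hl : l ≤ finrank E V) :
    (Nat.card {s : Fin l → V // LinearIndependent E s} : ℚ) =
      ∏ i ∈ Finset.range l, ((Nat.card E : ℚ) ^ finrank E V - (Nat.card E : ℚ) ^ i) := by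
  have := Fintype.ofFinite E
  rw [card_linearIndependent hl, Nat.card_eq_fintype_card, Nat.cast_prod,
    ← Fin.prod_univ_eq_prod_range
      (fun i => (Fintype.card E : ℚ) ^ finrank E V - (Fintype.card E : ℚ) ^ i)]
  refine Finset.prod_congr rfl fun i _ => ?_
  rw [Nat.cast_sub (Nat.pow_le_pow_right Fintype.card_pos (by omega))]
  simp

/-- Linearly independent families spanning `W` are the linearly independent families in `W`. -/
def linearIndependentSpanEquiv {l : ℕ} (W : Submodule E V) (hW : finrank E W = l) :
    {s : {s : Fin l → V // LinearIndependent E s} // Submodule.span E (Set.range s.1) = W} ≃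
      {s : Fin l → W // LinearIndependent E s} where
  toFun s := ⟨fun i => ⟨s.1.1 i, s.2.le (Submodule.subset_span ⟨i, rfl⟩)⟩,
    LinearIndependent.of_comp W.subtype s.1.2⟩
  invFun s := ⟨⟨fun i => s.1 i, s.2.map' W.subtype W.ker_subtype⟩, by
    have h : LinearIndependent E fun i => (s.1 i : V) := s.2.map' W.subtype W.ker_subtype
    refine Submodule.eq_of_le_of_finrank_eq ?_ ?_
    · rw [Submodule.span_le]
      rintro _ ⟨i, rfl⟩
      exact (s.1 i).2
    · rw [finrank_span_eq_card h, hW, Fintype.card_fin]⟩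
  left_inv _ := rfl
  right_inv _ := rfl

/-- Sort the independent `l`-families by their span: each subspace of dimension `l` receives the
same number of them, its ordered bases. -/
theorem card_submodule_finrank_eq (l : ℕ) :
    (Nat.card {W : Submodule E V // finrank E W = l} : ℚ) =
      gaussBinom (Nat.card E) (finrank E V) l := by
  classical
  have hQ : 2 ≤ Nat.card E := Finite.one_lt_card
  rcases lt_or_ge (finrank E V) l with h | h
  · rw [gaussBinom_eq_zero _ h]
    have : IsEmpty {W : Submodule E V // finrank E W = l} :=
      ⟨fun W => absurd (Submodule.finrank_le W.1) (by rw [W.2]; omega)⟩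
    simp
  have e := Equiv.sigmaFiberEquiv
    (fun s : {s : Fin l → V // LinearIndependent E s} =>
      (⟨Submodule.span E (Set.range s.1), by rw [finrank_span_eq_card s.2, Fintype.card_fin]⟩ :
        {W : Submodule E V // finrank E W = l}))
  have := Fintype.ofFinite {W : Submodule E V // finrank E W = l}
  have hc : (Nat.card {s : Fin l → V // LinearIndependent E s} : ℚ) =
      Nat.card {W : Submodule E V // finrank E W = l} *
        ∏ i ∈ Finset.range l, ((Nat.card E : ℚ) ^ l - (Nat.card E : ℚ) ^ i) := by
    have hfib : ∀ W : {W : Submodule E V // finrank E W = l}, (Nat.card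
        {s : {s : Fin l → V // LinearIndependent E s} //
          (⟨Submodule.span E (Set.range s.1), by
            rw [finrank_span_eq_card s.2, Fintype.card_fin]⟩ :
            {W : Submodule E V // finrank E W = l}) = W} : ℚ) =
        ∏ i ∈ Finset.range l, ((Nat.card E : ℚ) ^ l - (Nat.card E : ℚ) ^ i) := fun W => by
      rw [Nat.card_congr ((Equiv.subtypeEquivRight fun s => by rw [Subtype.ext_iff]).trans
        (linearIndependentSpanEquiv W.1 W.2)), card_linearIndependent_rat W.2.ge, W.2]
    rw [← Nat.card_congr e, Nat.card_sigma, Nat.cast_sum, Finset.sum_congr rfl fun W _ => hfib W,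
      Finset.sum_const, Finset.card_univ, nsmul_eq_mul, Nat.card_eq_fintype_card (α := {W // _})]
  rw [card_linearIndependent_rat h, prod_pow_sub_pow_eq_gaussBinom_mul hQ h] at hc
  refine (mul_right_cancel₀ (Finset.prod_ne_zero_iff.2 fun i hi => ?_) hc).symm
  have : (Nat.card E : ℚ) ^ i < (Nat.card E : ℚ) ^ l :=
    pow_lt_pow_right₀ (by exact_mod_cast hQ) (Finset.mem_range.1 hi)
  linarith

/-- The sum over all subspaces of a function of the dimension. -/
theorem sum_submodule_finrank [Fintype (Submodule E V)] (g : ℕ → ℚ) :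
    ∑ W : Submodule E V, g (finrank E W) =
      ∑ l ∈ Finset.range (finrank E V + 1),
        gaussBinom (Nat.card E) (finrank E V) l * g l := by
  classical
  rw [← Finset.sum_fiberwise_of_maps_to (t := Finset.range (finrank E V + 1))
    (g := fun W : Submodule E V => finrank E W)
    (fun W _ => Finset.mem_range_succ_iff.2 (Submodule.finrank_le W))]
  refine Finset.sum_congr rfl fun l _ => ?_
  rw [← card_submodule_finrank_eq (E := E) (V := V) l, Nat.card_eq_fintype_card,
    Fintype.card_subtype, Finset.sum_congr rfl (g := fun _ => g l), Finset.sum_const,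
    nsmul_eq_mul]
  intro W hW
  rw [(Finset.mem_filter.1 hW).2]

/-- The Möbius function of the lattice of subspaces. -/
theorem sum_moebius_submodule_le [Fintype (Submodule E V)] [DecidableLE (Submodule E V)]
    (K : Submodule E V) [Decidable (K = ⊥)] :
    ∑ W : Submodule E V with W ≤ K,
      (-1 : ℚ) ^ finrank E W * (Nat.card E : ℚ) ^ ((finrank E W).choose 2) =
      if K = ⊥ then 1 else 0 := by
  classical
  have := Fintype.ofFinite (Submodule E K)
  have h1 := sum_submodule_finrank (E := E) (V := K)
    (fun l => (-1 : ℚ) ^ l * (Nat.card E : ℚ) ^ (l.choose 2))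
  have h2 := sum_neg_one_pow_gaussBinom (Q := Nat.card E) Finite.one_lt_card (finrank E K)
  simp only [Submodule.finrank_eq_zero] at h2
  rw [← h2, Finset.sum_congr rfl (fun l _ => mul_comm _ (gaussBinom _ _ l)), ← h1]
  symm
  refine Finset.sum_bij (fun W _ => W.map K.subtype) ?_ ?_ ?_ ?_
  · intro W _
    simpa using Submodule.map_subtype_le K W
  · intro W _ W' _ h
    exact Submodule.map_injective_of_injective K.subtype_injective h
  · intro W hW
    have hW : W ≤ K := by simpa using hW
    exact ⟨W.comap K.subtype, Finset.mem_univ _, by simpa using hW⟩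
  · intro W _
    rw [Submodule.finrank_map_subtype_eq]

end Subspaces

/-! ### Counting invariant subsets -/

/-- If `m ∤ k`, no subset qualifies, in agreement with the default value `0` of `ratBinom`. -/
theorem natCast_card_eq_ratBinom {Z : Type*} (S : Finset Z) {m : ℕ} (hm : 0 < m) (k : ℕ) :
    (((S.powerset).filter fun C => C.card * m = k).card : ℚ) =
      ratBinom (S.card : ℚ) ((k : ℚ) / m) := by
  have hm' : (m : ℚ) ≠ 0 := by exact_mod_cast hm.ne'
  by_cases h : m ∣ k
  · obtain ⟨j, rfl⟩ := h
    have h1 : ((m * j : ℕ) : ℚ) / m = (j : ℚ) := by push_cast; field_simp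
    rw [h1, ratBinom, Nat.floor_natCast, if_pos rfl, Ring.choose_natCast, ← Finset.card_powersetCard,
      Finset.powersetCard_eq_filter]
    congr 3
    ext C
    rw [mul_comm, Nat.mul_right_inj hm.ne']
  · rw [ratBinom, if_neg, Finset.filter_false_of_mem]
    · simp
    · rintro C - rfl
      exact h (dvd_mul_left m _)
    · intro h'
      rw [div_eq_iff hm'] at h'
      exact h ⟨_, by rw [mul_comm]; exact_mod_cast h'⟩

theorem natCast_card_add_eq_ratBinom {Z : Type*} (S : Finset Z) {m : ℕ} (hm : 0 < m) (v k : ℕ) :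
    (((S.powerset).filter fun C => v + C.card * m = k).card : ℚ) =
      ratBinom (S.card : ℚ) (((k : ℚ) - v) / m) := by
  have hm' : (0 : ℚ) < m := by exact_mod_cast hm
  rcases le_or_gt v k with h | h
  · rw [← Nat.cast_sub h, ← natCast_card_eq_ratBinom S hm]
    congr 3
    ext C
    omega
  · have h2 : ((k : ℚ) - v) / m < 0 := div_neg_of_neg_of_pos (by
      rw [sub_neg]; exact_mod_cast h) hm'
    rw [ratBinom, if_neg, Finset.filter_false_of_mem]
    · simp
    · rintro C -
      omega
    · exact (h2.trans_le (Nat.cast_nonneg _)).ne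

/-- Weighted count of the subsets of a finite set with a distinguished point of weight `v`, all other
points having weight `m`. -/
theorem card_finset_weight_eq {Z : Type*} [Fintype Z] [DecidableEq Z] (z₀ : Z) (w : Z → ℕ)
    {v m : ℕ} (hm : 0 < m) (h₀ : w z₀ = v) (hw : ∀ z ≠ z₀, w z = m) (k : ℕ) :
    (Nat.card {C : Finset Z // ∑ z ∈ C, w z = k} : ℚ) =
      ratBinom ((Fintype.card Z - 1 : ℕ) : ℚ) ((k : ℚ) / m) +
        ratBinom ((Fintype.card Z - 1 : ℕ) : ℚ) (((k : ℚ) - v) / m) := by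
  have hS : (Finset.univ.erase z₀).card = Fintype.card Z - 1 := by
    rw [Finset.card_erase_of_mem (Finset.mem_univ _), Finset.card_univ]
  have hsum : ∀ C ∈ (Finset.univ.erase z₀).powerset, ∑ z ∈ C, w z = C.card * m := by
    intro C hC
    rw [Finset.sum_const_nat]
    intro z hz
    exact hw z (Finset.ne_of_mem_erase (Finset.mem_powerset.1 hC hz))
  have hnot : ∀ C ∈ (Finset.univ.erase z₀).powerset, z₀ ∉ C := fun C hC h =>
    Finset.notMem_erase z₀ _ (Finset.mem_powerset.1 hC h)
  -- The two binomials count the sets omitting `z₀` and those containing it.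
  rw [← hS, ← natCast_card_eq_ratBinom _ hm, ← natCast_card_add_eq_ratBinom _ hm, ← Nat.cast_add,
    Nat.card_eq_fintype_card, Fintype.card_subtype, ← Finset.powerset_univ,
    ← Finset.insert_erase (Finset.mem_univ z₀), Finset.powerset_insert, Finset.filter_union,
    Finset.card_union_of_disjoint, Finset.erase_insert (Finset.notMem_erase _ _)]
  · congr 2
    · exact congrArg _ (Finset.filter_congr fun C hC => by rw [hsum C hC])
    · rw [Finset.filter_image, Finset.card_image_of_injOn]
      · refine congrArg _ (Finset.filter_congr fun C hC => ?_)
        rw [Finset.sum_insert (hnot C hC), h₀, hsum C hC]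
      · intro C hC D hD h
        have hC := hnot C (Finset.mem_filter.1 hC).1
        have hD := hnot D (Finset.mem_filter.1 hD).1
        rw [← Finset.erase_insert hC, ← Finset.erase_insert hD]
        exact congrArg (fun s => s.erase z₀) h
  · rw [Finset.disjoint_left]
    intro C hC hC'
    obtain ⟨D, -, rfl⟩ := Finset.mem_image.1 (Finset.mem_filter.1 hC').1
    exact hnot _ (Finset.mem_filter.1 hC).1 (Finset.mem_insert_self _ _)

/-- Sets saturated with respect to a surjection correspond to sets of values. -/
theorem card_saturated_eq {X Z : Type*} [Finite X] [Fintype Z] (f : X → Z)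
    (hf : Function.Surjective f) (k : ℕ) :
    Nat.card {B : Set X // (∀ x y, f x = f y → (x ∈ B ↔ y ∈ B)) ∧ B.ncard = k} =
      Nat.card {C : Finset Z // ∑ z ∈ C, Nat.card {x // f x = z} = k} := by
  classical
  have hcard : ∀ C : Finset Z, (f ⁻¹' (C : Set Z)).ncard = ∑ z ∈ C, Nat.card {x // f x = z} := by
    intro C
    have := Fintype.ofFinite X
    rw [Set.ncard_eq_toFinset_card', Finset.card_eq_sum_card_fiberwise (f := f) (t := C)]
    · refine Finset.sum_congr rfl fun z hz => ?_
      rw [Nat.card_eq_fintype_card, Fintype.card_subtype]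
      congr 1
      ext x
      simp only [Finset.mem_filter, Set.mem_toFinset, Set.mem_preimage, Finset.mem_coe,
        Finset.mem_univ, true_and, and_iff_right_iff_imp]
      rintro rfl
      exact hz
    · intro x hx
      simpa using hx
  refine (Nat.card_congr (Equiv.ofBijective
    (fun C => ⟨f ⁻¹' (C.1 : Set Z), fun x y h => by simp [h], (hcard C.1).trans C.2⟩)
    ⟨?_, ?_⟩)).symm
  · intro C D h
    have h := hf.preimage_injective (Subtype.ext_iff.1 h)
    exact Subtype.ext (Finset.coe_injective h)
  · rintro ⟨B, hB, hk⟩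
    have hpre : f ⁻¹' (((f '' B).toFinset : Finset Z) : Set Z) = B := by
      ext x
      simp only [Set.coe_toFinset, Set.mem_preimage, Set.mem_image]
      exact ⟨fun ⟨y, hy, h⟩ => (hB y x h).1 hy, fun h => ⟨x, h, rfl⟩⟩
    refine ⟨⟨(f '' B).toFinset, ?_⟩, Subtype.ext hpre⟩
    rw [← hcard, hpre, hk]

section Invariant

variable {F : Type*} [Field F]

/-- The orbit relation of the group of maps `x ↦ a * x + w` with `a ∈ U` and `w ∈ W`. -/
def affineSetoid (U : Subgroup Fˣ) (W : AddSubgroup F)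
    (hUW : ∀ a ∈ U, ∀ w ∈ W, (a : F) * w ∈ W) : Setoid F where
  r x y := ∃ a ∈ U, (a : F) * x - y ∈ W
  iseqv := by
    refine ⟨fun x => ⟨1, U.one_mem, by simp⟩, ?_, ?_⟩
    · rintro x y ⟨a, ha, h⟩
      refine ⟨a⁻¹, U.inv_mem ha, ?_⟩
      have h2 := W.neg_mem (hUW _ (U.inv_mem ha) _ h)
      rwa [mul_sub, Units.inv_mul_cancel_left, neg_sub] at h2
    · rintro x y z ⟨a, ha, h⟩ ⟨b, hb, h'⟩
      refine ⟨b * a, U.mul_mem hb ha, ?_⟩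
      have h2 := W.add_mem (hUW _ hb _ h) h'
      rw [Units.val_mul]
      convert h2 using 1
      ring

variable [Finite F]

/-- Invariant sets are unions of orbits. The orbit of `0` is `W`; by `hfree`, `U` acts freely on the
nonzero classes modulo `W`, so all other orbits have `|U||W|` elements. -/
theorem card_invariant_set_eq_orbitCount (U : Subgroup Fˣ) (W : AddSubgroup F)
    (hUW : ∀ a ∈ U, ∀ w ∈ W, (a : F) * w ∈ W)
    (hfree : ∀ a ∈ U, a ≠ 1 → ∀ x, ((a : F) - 1) * x ∈ W → x ∈ W) (k : ℕ) :
    (Nat.card {B : Set F // ((∀ a ∈ U, ∀ x, (a : F) * x ∈ B ↔ x ∈ B) ∧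
      ∀ w ∈ W, ∀ x, x + w ∈ B ↔ x ∈ B) ∧ B.ncard = k} : ℚ) =
      orbitCount (Nat.card F) k (Nat.card U) (Nat.card W) := by
  classical
  let r := affineSetoid U W hUW
  have : Fintype (Quotient r) := Fintype.ofFinite _
  let f : F → Quotient r := Quotient.mk r
  have hf : ∀ x y, f x = f y ↔ ∃ a ∈ U, (a : F) * x - y ∈ W := fun x y => Quotient.eq
  have hsat : ∀ B : Set F, ((∀ a ∈ U, ∀ x, (a : F) * x ∈ B ↔ x ∈ B) ∧
      ∀ w ∈ W, ∀ x, x + w ∈ B ↔ x ∈ B) ↔ ∀ x y, f x = f y → (x ∈ B ↔ y ∈ B) := by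
    intro B
    constructor
    · rintro ⟨h1, h2⟩ x y hxy
      obtain ⟨a, ha, h⟩ := (hf x y).1 hxy
      rw [← h1 a ha x, ← h2 _ h y]
      simp
    · refine fun h => ⟨fun a ha x => (h _ _ ((hf _ _).2 ⟨a, ha, by simp⟩)).symm, fun w hw x =>
        (h _ _ ((hf _ _).2 ⟨1, U.one_mem, by simpa using hw⟩))⟩
  have hm : 0 < Nat.card U * Nat.card W := Nat.mul_pos Nat.card_pos Nat.card_pos
  have h₀ : Nat.card {x // f x = f 0} = Nat.card W := by
    refine Nat.card_congr (Equiv.subtypeEquivRight fun x => ?_)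
    rw [eq_comm, hf]
    refine ⟨fun ⟨a, _, h⟩ => by simpa using h, fun h => ⟨1, U.one_mem, by simpa using h⟩⟩
  have hw : ∀ z ≠ f 0, Nat.card {x // f x = z} = Nat.card U * Nat.card W := by
    intro z hz
    obtain ⟨y, rfl⟩ := Quotient.exists_rep z
    have hy : y ∉ W := fun h => hz (Eq.symm ((hf 0 y).2 ⟨1, U.one_mem, by simpa using h⟩))
    rw [← Nat.card_prod]
    refine (Nat.card_congr (Equiv.ofBijective (fun g : U × W =>
      (⟨(g.1 : Fˣ) * y - g.2, Eq.symm ((hf _ _).2 ⟨g.1, g.1.2, by simp⟩)⟩ : {x // f x = f y}))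
      ⟨?_, ?_⟩)).symm
    · rintro ⟨⟨a, ha⟩, ⟨w, hw⟩⟩ ⟨⟨b, hb⟩, ⟨w', hw'⟩⟩ h
      have h : (a : F) * y - w = (b : F) * y - w' := Subtype.ext_iff.1 h
      -- Distinct scalars would give `(b⁻¹a - 1)y ∈ W`, so `y ∈ W` by `hfree`.
      have hab : a = b := by
        by_contra hne
        refine hy (hfree (b⁻¹ * a) (U.mul_mem (U.inv_mem hb) ha) ?_ y ?_)
        · rwa [Ne, inv_mul_eq_one, eq_comm]
        · have h2 := hUW _ (U.inv_mem hb) _ (W.sub_mem hw hw')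
          have h3 : w - w' = (a : F) * y - b * y := by linear_combination -h
          rw [h3, mul_sub, Units.inv_mul_cancel_left] at h2
          rw [Units.val_mul, sub_mul, one_mul, mul_assoc]
          exact h2
      subst hab
      simpa using h
    · rintro ⟨x, hx⟩
      obtain ⟨a, ha, h⟩ := (hf y x).1 hx.symm
      exact ⟨⟨⟨a, ha⟩, ⟨_, h⟩⟩, by simp⟩
  have htot : Nat.card F = Nat.card W + (Fintype.card (Quotient r) - 1) *
      (Nat.card U * Nat.card W) := by
    rw [← Nat.card_congr (Equiv.sigmaFiberEquiv f), Nat.card_sigma,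
      ← Finset.add_sum_erase _ _ (Finset.mem_univ (f 0)), h₀, Finset.sum_const_nat
      (m := Nat.card U * Nat.card W) (fun z hz => hw z (Finset.ne_of_mem_erase hz)),
      Finset.card_erase_of_mem (Finset.mem_univ _), Finset.card_univ]
  rw [Nat.card_congr (Equiv.subtypeEquivRight fun B => by rw [hsat B]),
    card_saturated_eq f Quotient.mk_surjective, card_finset_weight_eq (f 0) _ hm h₀ hw k]
  have hx : ((Fintype.card (Quotient r) - 1 : ℕ) : ℚ) = ((Nat.card F : ℚ) - Nat.card W) /
      (Nat.card U * Nat.card W) := by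
    rw [eq_div_iff (by exact_mod_cast hm.ne')]
    have := congrArg (Nat.cast : ℕ → ℚ) htot
    push_cast at this
    linear_combination -this
  rw [hx, orbitCount, Nat.cast_mul]

end Invariant

/-! ### Roots of unity and multiplier fields in a finite field -/

section Multiplier

variable {F : Type*} [Field F]

/-- The multipliers of an additive subgroup of a finite field form a subfield. -/
def multiplierSubfield [Finite F] (H : AddSubgroup F) : Subfield F where
  carrier := multiplierSet H
  mul_mem' {x y} hx hy h hh := by rw [mul_assoc]; exact hx _ (hy _ hh)
  one_mem' h hh := by rwa [one_mul]
  add_mem' {x y} hx hy h hh := by rw [add_mul]; exact H.add_mem (hx _ hh) (hy _ hh)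
  zero_mem' h _ := by rw [zero_mul]; exact H.zero_mem
  neg_mem' {x} hx h hh := by rw [neg_mul]; exact H.neg_mem (hx _ hh)
  inv_mem' x hx := by
    rcases eq_or_ne x 0 with rfl | h0
    · simpa using hx
    have hpow : ∀ n : ℕ, x ^ n ∈ multiplierSet H := by
      intro n
      induction n with
      | zero => intro h hh; rwa [pow_zero, one_mul]
      | succ n ih => intro h hh; rw [pow_succ, mul_assoc]; exact ih _ (hx _ hh)
    -- By finiteness the inverse of `x` is a power of `x`.
    obtain ⟨n, hn, h1⟩ := isOfFinOrder_iff_pow_eq_one.1 (isOfFinOrder_of_finite (Units.mk0 x h0))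
    have h1 : x ^ n = 1 := by simpa [Units.ext_iff] using h1
    obtain ⟨m, rfl⟩ : ∃ m, n = m + 1 := ⟨n - 1, by omega⟩
    rw [← eq_inv_of_mul_eq_one_left (by rwa [← pow_succ])]
    exact hpow m

theorem mem_multiplierSubfield [Finite F] {H : AddSubgroup F} {x : F} :
    x ∈ multiplierSubfield H ↔ ∀ h ∈ H, x * h ∈ H := Iff.rfl

/-- The `u`-th roots of unity. -/
def unityRoots (F : Type*) [Field F] (u : ℕ) : Subgroup Fˣ := (powMonoidHom u).ker

theorem mem_unityRoots {u : ℕ} {a : Fˣ} : a ∈ unityRoots F u ↔ a ^ u = 1 := Iff.rfl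

theorem card_unityRoots [Finite F] {u : ℕ} (hu : u ∣ Nat.card Fˣ) :
    Nat.card (unityRoots F u) = u := by
  rw [unityRoots, IsCyclic.card_powMonoidHom_ker, Nat.gcd_eq_right hu]

/-- `Fˣ` is cyclic, so a subgroup is determined by its order. -/
theorem unityRoots_card_eq [Finite F] (A : Subgroup Fˣ) : unityRoots F (Nat.card A) = A := by
  refine (Subgroup.eq_of_le_of_card_ge (fun a ha => ?_) ?_).symm
  · have h := pow_card_eq_one' (x := (⟨a, ha⟩ : A))
    exact congrArg Subtype.val h
  · rw [card_unityRoots A.card_subgroup_dvd_card]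

theorem unityRoots_le_iff [Finite F] {u : ℕ} (hu : u ∣ Nat.card Fˣ) (A : Subgroup Fˣ) :
    unityRoots F u ≤ A ↔ u ∣ Nat.card A := by
  constructor
  · intro h
    have := Subgroup.card_dvd_of_le h
    rwa [card_unityRoots hu] at this
  · rintro ⟨m, hm⟩ a ha
    rw [← unityRoots_card_eq A, mem_unityRoots, hm, pow_mul, mem_unityRoots.1 ha, one_pow]

theorem card_subfield_units (E : Subfield F) :
    Nat.card E.toSubmonoid.units = Nat.card E - 1 := by
  rw [Nat.card_congr E.toSubmonoid.unitsEquivUnitsType.toEquiv]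
  exact Nat.card_units E

theorem mem_subfield_units {E : Subfield F} {a : Fˣ} :
    a ∈ E.toSubmonoid.units ↔ (a : F) ∈ E := by
  rw [Submonoid.mem_units_iff]
  exact ⟨fun h => h.1, fun h => ⟨h, by rw [Units.val_inv_eq_inv_val]; exact E.inv_mem h⟩⟩

/-- The subfield generated by the `u`-th roots of unity. -/
def unityRootsField (F : Type*) [Field F] (u : ℕ) : Subfield F :=
  Subfield.closure ((fun a : Fˣ => (a : F)) '' (unityRoots F u))

theorem unityRootsField_le_iff {u : ℕ} {K : Subfield F} :
    unityRootsField F u ≤ K ↔ ∀ a ∈ unityRoots F u, (a : F) ∈ K := by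
  rw [unityRootsField, Subfield.closure_le]
  simp [Set.subset_def]

theorem unityRootsField_le_multiplierSubfield [Finite F] {u : ℕ} {H : AddSubgroup F}
    (hu : u ∣ Nat.card (multiplierSet H) - 1) :
    unityRootsField F u ≤ multiplierSubfield H := by
  rw [unityRootsField_le_iff]
  intro a ha
  have h1 : u ∣ Nat.card (multiplierSubfield H).toSubmonoid.units := by
    rw [card_subfield_units]; exact hu
  exact mem_subfield_units.1
    ((unityRoots_le_iff (h1.trans (Subgroup.card_subgroup_dvd_card _)) _).2 h1 ha)

theorem card_multiplierSet_sub_one_dvd [Finite F] (H : AddSubgroup F) :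
    Nat.card (multiplierSet H) - 1 ∣ Nat.card Fˣ :=
  (card_subfield_units (multiplierSubfield H)).symm.dvd.trans (Subgroup.card_subgroup_dvd_card _)

theorem charP_of_card_eq {p α : ℕ} (hp : p.Prime) [Finite F] (hq : Nat.card F = p ^ α) :
    CharP F p := by
  have := Fintype.ofFinite F
  have : Fact p.Prime := ⟨hp⟩
  rw [Nat.card_eq_fintype_card] at hq
  exact charP_of_card_eq_prime_pow hq

theorem natCast_pow_eq_one_iff {p u n : ℕ} (hp : 0 < p) :
    (p : ZMod u) ^ n = 1 ↔ u ∣ p ^ n - 1 := by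
  rw [← ZMod.natCast_eq_zero_iff, Nat.cast_sub (Nat.one_le_pow _ _ hp), sub_eq_zero]
  push_cast
  rfl

/-- A field of order `p^d` containing the roots has `u ∣ p^d - 1`, so `o_u(p) ∣ d`. Conversely the
`o_u(p)`-th Frobenius iterate fixes the roots, hence the field they generate, which therefore
consists of roots of `X^(p^o) - X` with `o = o_u(p)`. -/
theorem card_unityRootsField [Finite F] {p α u : ℕ} (hp : p.Prime) (hq : Nat.card F = p ^ α)
    (hu : u ∣ Nat.card Fˣ) :
    Nat.card (unityRootsField F u) = p ^ multOrd u p := by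
  classical
  have : Fact p.Prime := ⟨hp⟩
  have : CharP F p := charP_of_card_eq hp hq
  set E := unityRootsField F u with hE
  have := Fintype.ofFinite E
  obtain ⟨d, -, hd⟩ := FiniteField.card E p
  rw [← Nat.card_eq_fintype_card] at hd
  have hdvd : multOrd u p ∣ d := by
    refine orderOf_dvd_of_pow_eq_one ((natCast_pow_eq_one_iff hp.pos).2 ?_)
    rw [← hd, ← card_subfield_units, ← unityRoots_le_iff hu]
    exact fun a ha => mem_subfield_units.2 (unityRootsField_le_iff.1 le_rfl a ha)
  -- This excludes the default value `0` of `orderOf`.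
  have hpos : 0 < multOrd u p := Nat.pos_of_dvd_of_pos hdvd d.pos
  refine le_antisymm ?_ (hd ▸ Nat.pow_le_pow_right hp.pos (Nat.le_of_dvd d.pos hdvd))
  have hN : 1 < p ^ multOrd u p := Nat.one_lt_pow hpos.ne' hp.one_lt
  have hfix : ∀ x ∈ E, x ^ p ^ multOrd u p = x := by
    have : E ≤ (iterateFrobenius F p (multOrd u p)).eqLocusField (RingHom.id F) := by
      rw [hE, unityRootsField_le_iff]
      intro a ha
      change (iterateFrobenius F p (multOrd u p)) (a : F) = a
      rw [iterateFrobenius_def]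
      obtain ⟨m, hm⟩ := (natCast_pow_eq_one_iff (u := u) hp.pos).1 (pow_orderOf_eq_one (p : ZMod u))
      have h1 : p ^ multOrd u p = u * m + 1 := by
        change p ^ multOrd u p - 1 = u * m at hm
        omega
      rw [h1, pow_succ, pow_mul]
      have h2 : (a : F) ^ u = 1 := by
        simpa using congrArg Units.val (mem_unityRoots.1 ha)
      rw [h2, one_pow, one_mul]
    intro x hx
    have := this hx
    change (iterateFrobenius F p (multOrd u p)) x = x at this
    rwa [iterateFrobenius_def] at this
  have hne := FiniteField.X_pow_card_sub_X_ne_zero F hN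
  have hsub : (E : Set F) ⊆
      ((Polynomial.X ^ p ^ multOrd u p - Polynomial.X : Polynomial F).roots.toFinset : Set F) := by
    intro x hx
    simpa [hne, sub_eq_zero] using hfix x hx
  calc Nat.card E = (E : Set F).ncard := rfl
    _ ≤ _ := Set.ncard_le_ncard hsub
    _ = _ := Set.ncard_coe_finset _
    _ ≤ _ := Multiset.toFinset_card_le _
    _ ≤ _ := Polynomial.card_roots' _
    _ = _ := FiniteField.X_pow_card_sub_X_natDegree_eq F hN

end Multiplier

/-! ### Translations and linear parts of the affine maps preserving a set -/

section Stabilizer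

variable {F : Type*} [Field F]

/-- The group of translations preserving `B`. -/
def transStab (B : Set F) : AddSubgroup F where
  carrier := {t | ∀ x, x + t ∈ B ↔ x ∈ B}
  zero_mem' x := by rw [add_zero]
  add_mem' {s t} hs ht x := by rw [← add_assoc, ht, hs]
  neg_mem' {t} ht x := by rw [← ht, neg_add_cancel_right]

theorem mem_transStab {B : Set F} {t : F} : t ∈ transStab B ↔ ∀ x, x + t ∈ B ↔ x ∈ B := Iff.rfl

/-- The group of linear parts of the affine maps preserving `B`. -/
def linearParts (B : Set F) : Subgroup Fˣ where
  carrier := {a | ∃ b, ∀ x, (a : F) * x + b ∈ B ↔ x ∈ B}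
  one_mem' := ⟨0, by simp⟩
  mul_mem' := by
    rintro a c ⟨b, hb⟩ ⟨d, hd⟩
    refine ⟨a * d + b, fun x => ?_⟩
    rw [← hd x, ← hb (c * x + d)]
    congr! 1
    push_cast
    ring
  inv_mem' := by
    rintro a ⟨b, hb⟩
    refine ⟨-(((a⁻¹ : Fˣ) : F) * b), fun x => ?_⟩
    rw [← hb]
    congr! 1
    rw [mul_add, Units.mul_inv_cancel_left, mul_neg, Units.mul_inv_cancel_left]
    ring

/-- Conjugating the translation by `t` with `x ↦ ax + b` gives the translation by `at`. -/
theorem mul_mem_transStab_of_affine {a : Fˣ} {b : F} {B : Set F}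
    (ha : ∀ x, (a : F) * x + b ∈ B ↔ x ∈ B) {t : F}
    (ht : t ∈ transStab B) : (a : F) * t ∈ transStab B := by
  intro x
  have h : x + a * t = a * (((a⁻¹ : Fˣ) : F) * (x - b) + t) + b := by
    rw [mul_add, Units.mul_inv_cancel_left]; ring
  rw [h, ha, mem_transStab.1 ht, ← ha, Units.mul_inv_cancel_left, sub_add_cancel]

theorem mul_mem_transStab {a : Fˣ} {B : Set F} (ha : ∀ x, (a : F) * x ∈ B ↔ x ∈ B) {t : F}
    (ht : t ∈ transStab B) : (a : F) * t ∈ transStab B :=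
  mul_mem_transStab_of_affine (b := 0) (by simpa using ha) ht

theorem card_linearParts_dvd [Finite F] (B : Set F) :
    Nat.card (linearParts B) ∣ Nat.card (multiplierSet (transStab B)) - 1 := by
  have h : linearParts B ≤ (multiplierSubfield (transStab B)).toSubmonoid.units := by
    rintro a ⟨b, hb⟩
    exact mem_subfield_units.2 fun t ht => mul_mem_transStab_of_affine hb ht
  exact (Subgroup.card_dvd_of_le h).trans (card_subfield_units _).dvd

end Stabilizer

/-! ### Counting subsets with a given group of translations -/

section Count

variable {F : Type*} [Field F]

/-- The group of scalars preserving `B`. -/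
def scalarStab (B : Set F) : Subgroup Fˣ where
  carrier := {a | ∀ x, (a : F) * x ∈ B ↔ x ∈ B}
  one_mem' x := by simp
  mul_mem' {a c} ha hc x := by rw [Units.val_mul, mul_assoc, ha, hc]
  inv_mem' {a} ha x := by rw [← ha, Units.mul_inv_cancel_left]

theorem transStab_preimage_add (B : Set F) (c : F) :
    transStab ((· + c) ⁻¹' B) = transStab B := by
  ext t
  simp only [mem_transStab, Set.mem_preimage]
  refine ⟨fun h x => ?_, fun h x => by rw [← h (x + c), add_right_comm]⟩
  have := h (x - c)
  rwa [sub_add_cancel, add_right_comm, sub_add_cancel] at this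

theorem ncard_preimage_add (B : Set F) (c : F) : ((· + c) ⁻¹' B).ncard = B.ncard :=
  Set.ncard_preimage_of_injective_subset_range (add_left_injective c)
    fun x _ => ⟨x - c, sub_add_cancel x c⟩

theorem affine_mem_iff_add_mem_transStab {a : Fˣ} {b b' : F} {B : Set F}
    (h : ∀ x, (a : F) * x + b ∈ B ↔ x ∈ B) :
    (∀ x, (a : F) * x + b' ∈ B ↔ x ∈ B) ↔ b' - b ∈ transStab B := by
  rw [mem_transStab]
  constructor
  · intro h' y
    obtain ⟨x, rfl⟩ : ∃ x, y = a * x + b :=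
      ⟨((a⁻¹ : Fˣ) : F) * (y - b), by rw [Units.mul_inv_cancel_left, sub_add_cancel]⟩
    rw [h x, ← h' x]
    congr! 1
    ring
  · intro h' x
    rw [← h x, ← h' (a * x + b)]
    congr! 1
    ring

/-- A set preserved by an affine map with linear part `ζ ≠ 1` is a translate of a set preserved by
`ζ`; the translation vector is unique modulo the translations preserving the set. -/
theorem card_mem_linearParts_mul_card [Finite F] (H : AddSubgroup F) {ζ : Fˣ} (hζ : ζ ≠ 1)
    (hmul : ((ζ : F) - 1)⁻¹ ∈ multiplierSubfield H) (k : ℕ) :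
    Nat.card {B : Set F // ζ ∈ linearParts B ∧ transStab B = H ∧ B.ncard = k} * Nat.card H =
      Nat.card F * Nat.card {B : Set F // ζ ∈ scalarStab B ∧ transStab B = H ∧ B.ncard = k} := by
  classical
  have := Fintype.ofFinite F
  have hζ0 : (ζ : F) - 1 ≠ 0 := sub_ne_zero.2 fun h => hζ (Units.ext h)
  -- Both `1 - ζ` and its inverse lie in the multiplier field.
  have hmem : ∀ x, ((1 : F) - ζ) * x ∈ H ↔ x ∈ H := by
    intro x
    constructor
    · intro h
      have h2 := H.neg_mem (hmul _ h)
      have : -(((ζ : F) - 1)⁻¹ * ((1 - ζ) * x)) = x := by field_simp; ring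
      rwa [this] at h2
    · intro h
      refine mem_multiplierSubfield.1 ?_ x h
      rw [← neg_sub]
      exact neg_mem (inv_mem_iff.1 hmul)
  rw [Nat.card_eq_fintype_card, Fintype.card_subtype,
    Nat.card_eq_fintype_card (α := F), ← Finset.card_univ,
    Nat.card_eq_fintype_card (α := {B : Set F // _}), Fintype.card_subtype]
  symm
  -- Double count the pairs `(c, B)` with `B` preserved by the map of ratio `ζ` fixing `c`. For
  -- fixed `c`, translation moves the centre to `0`; for fixed `B`, the centres form a coset of `H`.
  refine Finset.card_mul_eq_card_mul
    (fun (c : F) (B : Set F) => ∀ x, (ζ : F) * x + (1 - ζ) * c ∈ B ↔ x ∈ B) ?_ ?_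
  · intro c _
    refine Finset.card_nbij' (fun B => (· + c) ⁻¹' B) (fun B => (· + -c) ⁻¹' B) ?_ ?_ ?_ ?_
    · intro B hB
      simp only [Finset.coe_bipartiteAbove, Finset.coe_filter, Finset.mem_univ, Set.mem_ofPred_eq,
        true_and, Finset.mem_filter] at hB ⊢
      obtain ⟨⟨-, h1, h2⟩, h⟩ := hB
      rw [transStab_preimage_add, ncard_preimage_add]
      refine ⟨fun x => ?_, h1, h2⟩
      rw [Set.mem_preimage, Set.mem_preimage, ← h (x + c)]
      congr! 1
      ring
    · intro B hB
      simp only [Finset.coe_bipartiteAbove, Finset.coe_filter, Finset.mem_univ, Set.mem_ofPred_eq,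
        true_and, Finset.mem_filter] at hB ⊢
      obtain ⟨h, h1, h2⟩ := hB
      have key : ∀ x, (ζ : F) * x + (1 - ζ) * c ∈ (· + -c) ⁻¹' B ↔ x ∈ (· + -c) ⁻¹' B := by
        intro x
        rw [Set.mem_preimage, Set.mem_preimage, ← h (x + -c)]
        congr! 1
        ring
      rw [transStab_preimage_add, ncard_preimage_add]
      exact ⟨⟨⟨_, key⟩, h1, h2⟩, key⟩
    · intro B _
      ext x
      simp
    · intro B _
      ext x
      simp
  · intro B hB
    obtain ⟨-, ⟨b, hb⟩, h1, -⟩ := Finset.mem_filter.1 hB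
    rw [Nat.card_eq_fintype_card, Fintype.card_subtype]
    have hc : ∀ c : F, (∀ x, (ζ : F) * x + (1 - ζ) * c ∈ B ↔ x ∈ B) ↔
        c + b / (ζ - 1) ∈ H := by
      intro c
      rw [affine_mem_iff_add_mem_transStab hb, h1, ← hmem (c + b / (ζ - 1))]
      congr! 1
      field_simp
      ring
    refine Finset.card_nbij' (fun c => c + b / (ζ - 1)) (fun h => h - b / (ζ - 1)) ?_ ?_ ?_ ?_
    · intro c hcB
      simpa [hc] using hcB
    · intro h hh
      simpa [hc] using hh
    · intro c _
      simp
    · intro c _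
      simp

open Module in
-- Preimages under the quotient map keep the index, so Lagrange upstairs and downstairs can be
-- compared.
theorem card_comap_mkQ [Finite F] {E : Subfield F} (K : Submodule E F) (W : Submodule E (F ⧸ K)) :
    Nat.card (W.comap K.mkQ) = Nat.card K * Nat.card E ^ finrank E W := by
  have h1 := AddSubgroup.index_comap_of_surjective W.toAddSubgroup
    (f := K.mkQ.toAddMonoidHom) K.mkQ_surjective
  have h2 := AddSubgroup.card_mul_index W.toAddSubgroup
  have h3 := AddSubgroup.card_mul_index (W.toAddSubgroup.comap K.mkQ.toAddMonoidHom)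
  have h4 := K.card_eq_card_quotient_mul_card
  have : Finite (F ⧸ K) := Finite.of_surjective _ K.mkQ_surjective
  have h5 : W.toAddSubgroup.index ≠ 0 := by
    refine right_ne_zero_of_mul (a := Nat.card W) ?_
    exact h2.trans_ne Nat.card_pos.ne'
  rw [← natCard_eq_pow_finrank (K := E)]
  refine Nat.eq_of_mul_eq_mul_right (Nat.pos_of_ne_zero h5) ?_
  rw [mul_assoc]
  refine Eq.trans (b := Nat.card F) ?_ ?_
  · rw [← h1]; exact h3
  · rw [h4, ← h2]; rfl

/-- Möbius inversion over the subspaces above `H`. -/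
theorem card_transStab_eq [Finite F] {p α β u : ℕ} (hp : p.Prime) (hq : Nat.card F = p ^ α)
    (H : AddSubgroup F) (hH : Nat.card H = p ^ β) (hu : u ∣ Nat.card (multiplierSet H) - 1)
    (k : ℕ) :
    (Nat.card {B : Set F // unityRoots F u ≤ scalarStab B ∧ transStab B = H ∧ B.ncard = k} : ℚ) =
      ∑ l ∈ Finset.range ((α - β) / multOrd u p + 1),
        (-1 : ℚ) ^ l * (p : ℚ) ^ (multOrd u p * l.choose 2) *
          gaussBinom (p ^ multOrd u p) ((α - β) / multOrd u p) l *
          orbitCount (p ^ α) k u (p ^ (β + l * multOrd u p)) := by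
  classical
  have := Fintype.ofFinite F
  have huF := hu.trans (card_multiplierSet_sub_one_dvd H)
  have hEc := card_unityRootsField hp hq huF
  have hEH := unityRootsField_le_multiplierSubfield hu
  have hUE : ∀ a ∈ unityRoots F u, (a : F) ∈ unityRootsField F u :=
    unityRootsField_le_iff.1 le_rfl
  set o := multOrd u p with ho
  set E := unityRootsField F u with hE
  -- `H` is an `E`-space because `E` lies in its multiplier field.
  let K : Submodule E F := { H with smul_mem' := fun c x hx => hEH c.2 x hx }
  have hKc : Nat.card K = p ^ β := hH
  have := Fintype.ofFinite (Submodule E (F ⧸ K))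
  have ho0 : 0 < o := by
    rcases Nat.eq_zero_or_pos o with h | h
    · have : 1 < Nat.card E := Finite.one_lt_card
      rw [hEc, h] at this
      simp at this
    · exact h
  -- The division is exact: `α = β + o * finrank E (F ⧸ K)`.
  have hfr : Module.finrank E (F ⧸ K) = (α - β) / o := by
    have h1 := K.card_eq_card_quotient_mul_card
    rw [hKc, hq, Module.natCard_eq_pow_finrank (K := E), hEc, ← pow_mul, ← pow_add] at h1
    have h2 := Nat.pow_right_injective hp.two_le h1
    rw [h2, Nat.add_sub_cancel_left, Nat.mul_div_cancel_left _ ho0]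
  let μ : ℕ → ℚ := fun l => (-1 : ℚ) ^ l * ((p ^ o : ℕ) : ℚ) ^ (l.choose 2)
  let L : Submodule E (F ⧸ K) → AddSubgroup F := fun W => (W.comap K.mkQ).toAddSubgroup
  have hL : ∀ W x, x ∈ L W ↔ x ∈ W.comap K.mkQ := fun _ _ => Iff.rfl
  have hLc : ∀ W, Nat.card (L W) = p ^ (β + Module.finrank E W * o) := by
    intro W
    rw [pow_add, ← hH, mul_comm _ o, pow_mul, ← hEc]
    exact card_comap_mkQ K W
  -- If `H ≤ transStab B`, then `transStab B` is an `E`-space `T`, and the sum runs over the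
  -- subspaces of `T/H`; it is `1` or `0` according as `T = H` or not. Otherwise no `W` contributes,
  -- since every `L W` contains `H`.
  have hmoeb : ∀ B : Set F, unityRoots F u ≤ scalarStab B →
      (if transStab B = H then 1 else 0 : ℚ) =
        ∑ W : Submodule E (F ⧸ K), if L W ≤ transStab B then μ (Module.finrank E W) else 0 := by
    intro B hB
    by_cases hHB : H ≤ transStab B
    · have hst : E ≤ multiplierSubfield (transStab B) := by
        rw [hE, unityRootsField_le_iff]
        exact fun a ha t ht => mul_mem_transStab (hB ha) ht
      let T : Submodule E F := { transStab B with smul_mem' := fun c x hx => hst c.2 x hx }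
      have hKT : K ≤ T := hHB
      have h1 : ∀ W, L W ≤ transStab B ↔ W ≤ T.map K.mkQ := by
        intro W
        rw [← (Submodule.comap_le_comap_iff_of_surjective K.mkQ_surjective),
          Submodule.comap_map_mkQ, sup_eq_right.2 hKT]
        rfl
      have h2 : T.map K.mkQ = ⊥ ↔ transStab B = H := by
        rw [← LinearMap.le_ker_iff_map, Submodule.ker_mkQ]
        exact ⟨fun h => le_antisymm h hHB, fun h => h.le⟩
      rw [← Finset.sum_filter, Finset.filter_congr fun W _ => h1 W]
      have h3 := sum_moebius_submodule_le (T.map K.mkQ)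
      rw [hEc] at h3
      rw [h3]
      simp only [h2]
    · rw [if_neg fun h => hHB h.ge, Finset.sum_eq_zero]
      intro W _
      rw [if_neg]
      intro h
      refine hHB (le_trans (fun x hx => ?_) h)
      rw [hL, Submodule.mem_comap, (K.mkQ_apply x), (Submodule.Quotient.mk_eq_zero K).2 hx]
      exact W.zero_mem
  have hcount : ∀ W, (Nat.card {B : Set F // (unityRoots F u ≤ scalarStab B ∧
      L W ≤ transStab B) ∧ B.ncard = k} : ℚ) =
      orbitCount (p ^ α) k u (p ^ (β + Module.finrank E W * o)) := by
    intro W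
    rw [← hLc, ← hq]
    conv_rhs => rw [← card_unityRoots huF]
    refine card_invariant_set_eq_orbitCount (unityRoots F u) (L W) ?_ ?_ k
    · intro a ha w hw
      exact (W.comap K.mkQ).smul_mem (⟨a, hUE a ha⟩ : E) hw
    -- For `a ≠ 1`, `a - 1` is invertible in `E`, and `L W` is an `E`-space.
    · intro a ha ha1 x hx
      have h0 : (a : F) - 1 ≠ 0 := sub_ne_zero.2 fun h => ha1 (Units.ext h)
      have h1 := (W.comap K.mkQ).smul_mem
        ((⟨(a : F) - 1, sub_mem (hUE a ha) E.one_mem⟩ : E)⁻¹) hx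
      have h2 : ((⟨(a : F) - 1, sub_mem (hUE a ha) E.one_mem⟩ : E)⁻¹) • (((a : F) - 1) * x) = x :=
        inv_mul_cancel_left₀ h0 x
      rwa [h2] at h1
  have hsum := sum_submodule_finrank (E := E) (V := F ⧸ K)
    (fun l => μ l * orbitCount (p ^ α) k u (p ^ (β + l * o)))
  rw [hfr, hEc] at hsum
  calc _ = ∑ B : Set F with unityRoots F u ≤ scalarStab B ∧ B.ncard = k,
        (if transStab B = H then 1 else 0 : ℚ) := by
        rw [Nat.card_eq_fintype_card, Fintype.card_subtype, Finset.sum_boole, Finset.filter_filter]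
        congr 3
        ext B
        tauto
    _ = ∑ B : Set F with unityRoots F u ≤ scalarStab B ∧ B.ncard = k,
        ∑ W : Submodule E (F ⧸ K), if L W ≤ transStab B then μ (Module.finrank E W) else 0 :=
        Finset.sum_congr rfl fun B hB => hmoeb B (Finset.mem_filter.1 hB).2.1
    _ = ∑ W : Submodule E (F ⧸ K), μ (Module.finrank E W) *
          orbitCount (p ^ α) k u (p ^ (β + Module.finrank E W * o)) := by
        rw [Finset.sum_comm]
        refine Finset.sum_congr rfl fun W _ => ?_
        rw [← hcount W, ← Finset.sum_filter, Finset.sum_const, nsmul_eq_mul, mul_comm,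
          Finset.filter_filter, Nat.card_eq_fintype_card, Fintype.card_subtype]
        congr 4
        ext B
        tauto
    _ = _ := by
        rw [hsum]
        refine Finset.sum_congr rfl fun l _ => ?_
        simp only [μ]
        rw [Nat.cast_pow, ← pow_mul]
        ring

end Count

/-! ### Stabilizers in the affine group -/

section Affine

variable {F : Type*} [Field F]

theorem AGL1.exists_eq_mk (g : AGL1 F) : ∃ (a : Fˣ) (b : F), g = AGL1.mk a b := by
  obtain ⟨g, a, b, ha, hg⟩ := g
  exact ⟨Units.mk0 a ha, b, Subtype.ext (Units.ext hg)⟩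

theorem AGL1.mk_eq_mk_iff {a a' : Fˣ} {b b' : F} :
    AGL1.mk a b = AGL1.mk a' b' ↔ a = a' ∧ b = b' := by
  refine ⟨fun h => ?_, by rintro ⟨rfl, rfl⟩; rfl⟩
  have h : (!![(a : F), b; 0, 1] : Matrix (Fin 2) (Fin 2) F) = !![(a' : F), b'; 0, 1] :=
    congrArg (fun g : AGL1 F => (g.1 : Matrix (Fin 2) (Fin 2) F)) h
  exact ⟨Units.ext (by simpa using congrFun (congrFun h 0) 0),
    by simpa using congrFun (congrFun h 0) 1⟩

theorem AGL1.mk_mul_mk (a a' : Fˣ) (b b' : F) :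
    AGL1.mk a b * AGL1.mk a' b' = AGL1.mk (a * a') (a * b' + b) := by
  refine Subtype.ext (Units.ext ?_)
  change (!![(a : F), b; 0, 1] : Matrix (Fin 2) (Fin 2) F) * !![(a' : F), b'; 0, 1] =
    !![((a * a' : Fˣ) : F), a * b' + b; 0, 1]
  simp

theorem AGL1.mk_one_zero : AGL1.mk (1 : Fˣ) (0 : F) = 1 :=
  Subtype.ext (Units.ext (by
    change (!![((1 : Fˣ) : F), 0; 0, 1] : Matrix (Fin 2) (Fin 2) F) = 1
    simp [Matrix.one_fin_two]))

theorem AGL1.mem_S_one_zero {H : AddSubgroup F} {g : AGL1 F} :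
    g ∈ AGL1.S 1 0 H ↔ ∃ h ∈ H, g = AGL1.mk 1 h := by
  constructor
  · intro hg
    induction hg using Subgroup.closure_induction with
    | mem x hx =>
      rcases hx with hx | hx
      · exact ⟨0, H.zero_mem, hx⟩
      · exact hx
    | one => exact ⟨0, H.zero_mem, AGL1.mk_one_zero.symm⟩
    | mul x y _ _ hx hy =>
      obtain ⟨h, hh, rfl⟩ := hx
      obtain ⟨h', hh', rfl⟩ := hy
      exact ⟨h' + h, H.add_mem hh' hh, by simp [AGL1.mk_mul_mk]⟩
    | inv x _ hx =>
      obtain ⟨h, hh, rfl⟩ := hx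
      refine ⟨-h, H.neg_mem hh, inv_eq_of_mul_eq_one_right ?_⟩
      rw [AGL1.mk_mul_mk, ← AGL1.mk_one_zero]
      simp
  · exact fun h => Subgroup.subset_closure (Or.inr h)

theorem stabilizer_eq_S_one_zero_iff (H : AddSubgroup F) (B : Set F) :
    MulAction.stabilizer (AGL1 F) B = AGL1.S 1 0 H ↔ linearParts B = ⊥ ∧ transStab B = H := by
  have hmk : ∀ a b, AGL1.mk a b ∈ MulAction.stabilizer (AGL1 F) B ↔
      ∀ x, (a : F) * x + b ∈ B ↔ x ∈ B := fun a b => MulAction.mem_stabilizer_set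
  have hmk' : ∀ a b, AGL1.mk a b ∈ AGL1.S 1 0 H ↔ a = 1 ∧ b ∈ H := by
    intro a b
    rw [AGL1.mem_S_one_zero]
    simp only [AGL1.mk_eq_mk_iff]
    exact ⟨fun ⟨h, hh, ha, hb⟩ => ⟨ha, hb ▸ hh⟩, fun ⟨ha, hb⟩ => ⟨b, hb, ha, rfl⟩⟩
  constructor
  · intro h
    refine ⟨?_, ?_⟩
    · rw [eq_bot_iff]
      rintro a ⟨b, hb⟩
      rw [← hmk, h, hmk'] at hb
      exact hb.1
    · ext t
      have := (hmk 1 t).symm.trans (h ▸ hmk' 1 t)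
      simpa [mem_transStab] using this
  · rintro ⟨h1, rfl⟩
    ext g
    obtain ⟨a, b, rfl⟩ := AGL1.exists_eq_mk g
    rw [hmk, hmk']
    constructor
    · intro h
      have ha : a = 1 := by
        rw [← Subgroup.mem_bot, ← h1]
        exact ⟨b, h⟩
      subst ha
      exact ⟨rfl, by simpa [mem_transStab] using h⟩
    · rintro ⟨rfl, hb⟩
      simpa [mem_transStab] using hb

/-! ### Inclusion–exclusion over the order of the group of linear parts -/

/-- Only sets of primes dividing `m` contribute, and their alternating sum vanishes unless `m` has
no prime factor. Indexing by the primes of `N` makes the range independent of `m`, so that it can be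
summed over all `B`. -/
theorem sum_neg_one_pow_prod_dvd {N m : ℕ} (hN : N ≠ 0) (hm : m ∣ N) :
    ∑ P ∈ N.primeFactors.powerset, (if ∏ e ∈ P, e ∣ m then (-1 : ℚ) ^ P.card else 0) =
      if m = 1 then 1 else 0 := by
  have hm0 : m ≠ 0 := ne_zero_of_dvd_ne_zero hN hm
  have h : N.primeFactors.powerset.filter (fun P => ∏ e ∈ P, e ∣ m) = m.primeFactors.powerset := by
    ext P
    rw [Finset.mem_filter, Finset.mem_powerset, Finset.mem_powerset]
    constructor
    · rintro ⟨h1, h2⟩ e he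
      exact Nat.mem_primeFactors.2 ⟨Nat.prime_of_mem_primeFactors (h1 he),
        (Finset.dvd_prod_of_mem _ he).trans h2, hm0⟩
    · intro h1
      exact ⟨h1.trans (Nat.primeFactors_mono hm hN),
        (Finset.prod_dvd_prod_of_subset _ _ _ h1).trans (Nat.prod_primeFactors_dvd m)⟩
  have h2 := congrArg (Int.cast : ℤ → ℚ) (Finset.sum_powerset_neg_one_pow_card
    (x := m.primeFactors))
  push_cast at h2
  rw [← Finset.sum_filter, h, h2]
  simp [Nat.primeFactors_eq_empty, hm0]

theorem stabCount_eq_sum_powerset [Finite F] (H : AddSubgroup F) (k : ℕ) :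
    (stabCount (AGL1.S 1 0 H) k : ℚ) =
      ∑ P ∈ (Nat.card (multiplierSet H) - 1).primeFactors.powerset, (-1 : ℚ) ^ P.card *
        Nat.card {B : Set F // unityRoots F (∏ e ∈ P, e) ≤ linearParts B ∧
          transStab B = H ∧ B.ncard = k} := by
  classical
  have := Fintype.ofFinite F
  have hN : Nat.card (multiplierSet H) - 1 ≠ 0 := by
    have : 1 < Nat.card (multiplierSubfield H) := Finite.one_lt_card
    exact Nat.sub_ne_zero_of_lt this
  calc _ = ∑ B : Set F with transStab B = H ∧ B.ncard = k,
        (if Nat.card (linearParts B) = 1 then 1 else 0 : ℚ) := by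
        rw [stabCount, Nat.card_eq_fintype_card, Fintype.card_subtype, Finset.sum_boole,
          Finset.filter_filter]
        congr 3
        ext B
        rw [stabilizer_eq_S_one_zero_iff, Subgroup.card_eq_one]
        tauto
    _ = ∑ B : Set F with transStab B = H ∧ B.ncard = k,
        ∑ P ∈ (Nat.card (multiplierSet H) - 1).primeFactors.powerset,
          (if ∏ e ∈ P, e ∣ Nat.card (linearParts B) then (-1 : ℚ) ^ P.card else 0) := by
        refine Finset.sum_congr rfl fun B hB => ?_
        obtain ⟨-, rfl, -⟩ := Finset.mem_filter.1 hB
        rw [sum_neg_one_pow_prod_dvd hN (card_linearParts_dvd B)]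
    _ = _ := by
        rw [Finset.sum_comm]
        refine Finset.sum_congr rfl fun P hP => ?_
        have hdvd : ∏ e ∈ P, e ∣ Nat.card Fˣ :=
          ((Finset.prod_dvd_prod_of_subset _ _ _ (Finset.mem_powerset.1 hP)).trans
            (Nat.prod_primeFactors_dvd _)).trans (card_multiplierSet_sub_one_dvd H)
        rw [← Finset.sum_filter, Finset.sum_const, nsmul_eq_mul, mul_comm,
          Finset.filter_filter, Nat.card_eq_fintype_card, Fintype.card_subtype]
        congr 4
        ext B
        rw [unityRoots_le_iff hdvd]
        tauto

/-- The roots of unity are generated by a single `ζ ≠ 1`, so both conditions concern `ζ` alone and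
`card_mem_linearParts_mul_card` applies, with `|F|/|H| = p^(α-β)`. -/
theorem card_unityRoots_le_linearParts [Finite F] {p α β u : ℕ} (hp : p.Prime)
    (hq : Nat.card F = p ^ α) (H : AddSubgroup F) (hH : Nat.card H = p ^ β) (hu1 : u ≠ 1)
    (hu : u ∣ Nat.card (multiplierSet H) - 1) (k : ℕ) :
    Nat.card {B : Set F // unityRoots F u ≤ linearParts B ∧ transStab B = H ∧ B.ncard = k} =
      p ^ (α - β) *
        Nat.card {B : Set F // unityRoots F u ≤ scalarStab B ∧ transStab B = H ∧ B.ncard = k} := by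
  have hcard := card_unityRoots (hu.trans (card_multiplierSet_sub_one_dvd H))
  obtain ⟨ζ, hζ⟩ := IsCyclic.exists_generator (α := unityRoots F u)
  have hz : unityRoots F u = Subgroup.zpowers (ζ : Fˣ) := by
    refine le_antisymm (fun a ha => ?_) (by simp)
    obtain ⟨n, hn⟩ := hζ ⟨a, ha⟩
    exact ⟨n, congrArg Subtype.val hn⟩
  have hζ1 : (ζ : Fˣ) ≠ 1 := by
    intro h
    rw [h, Subgroup.zpowers_one_eq_bot] at hz
    rw [hz, Subgroup.card_bot] at hcard
    exact hu1 hcard.symm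
  have hmul : (((ζ : Fˣ) : F) - 1)⁻¹ ∈ multiplierSubfield H :=
    inv_mem (sub_mem (unityRootsField_le_multiplierSubfield hu
      (unityRootsField_le_iff.1 le_rfl _ ζ.2)) (one_mem _))
  have h := card_mem_linearParts_mul_card H hζ1 hmul k
  have hle : β ≤ α := by
    have h1 := H.card_addSubgroup_dvd_card
    rw [hq, hH] at h1
    exact (Nat.pow_dvd_pow_iff_le_right hp.one_lt).1 h1
  rw [hz]
  simp only [Subgroup.zpowers_le]
  rw [hq, hH] at h
  refine Nat.eq_of_mul_eq_mul_right (pow_pos hp.pos β) (h.trans ?_)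
  rw [mul_right_comm, ← pow_add, Nat.sub_add_cancel hle]

end Affine

theorem theorem4p2 {F : Type*} [Field F] [Finite F] (p α β k : ℕ) (hp : p.Prime)
    (hq : Nat.card F = p ^ α) (H : AddSubgroup F) (hH : Nat.card H = p ^ β)
    (hk : k ≤ p ^ α) :
    (stabCount (AGL1.S 1 0 H) k : ℚ) =
      (1 - (p : ℚ) ^ (α - β)) *
        ∑ l ∈ Finset.range (α - β + 1),
          (-1 : ℚ) ^ l * (p : ℚ) ^ (l.choose 2) * gaussBinom p (α - β) l *
            orbitCount (p ^ α) k 1 (p ^ (β + l)) +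
      (p : ℚ) ^ (α - β) *
        ∑ P ∈ (Nat.card (multiplierSet H) - 1).primeFactors.powerset,
          ∑ l ∈ Finset.range ((α - β) / multOrd (∏ e ∈ P, e) p + 1),
            (-1 : ℚ) ^ (P.card + l) * (p : ℚ) ^ (multOrd (∏ e ∈ P, e) p * l.choose 2) *
              gaussBinom (p ^ multOrd (∏ e ∈ P, e) p)
                ((α - β) / multOrd (∏ e ∈ P, e) p) l *
              orbitCount (p ^ α) k (∏ e ∈ P, e) (p ^ (β + l * multOrd (∏ e ∈ P, e) p)) := by
  -- For `P = ∅` both root conditions are vacuous and the factor is `1`, written as `(1 - p^(α-β)) +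
  -- p^(α-β)` to keep the sum over `P` uniform.
  have hterm : ∀ P ∈ (Nat.card (multiplierSet H) - 1).primeFactors.powerset,
      (-1 : ℚ) ^ P.card * Nat.card {B : Set F // unityRoots F (∏ e ∈ P, e) ≤ linearParts B ∧
          transStab B = H ∧ B.ncard = k} =
        (if P = ∅ then (1 - (p : ℚ) ^ (α - β)) * Nat.card {B : Set F //
          unityRoots F 1 ≤ scalarStab B ∧ transStab B = H ∧ B.ncard = k} else 0) +
        (p : ℚ) ^ (α - β) * ((-1 : ℚ) ^ P.card * Nat.card {B : Set F //
          unityRoots F (∏ e ∈ P, e) ≤ scalarStab B ∧ transStab B = H ∧ B.ncard = k}) := by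
    intro P hP
    by_cases h : P = ∅
    · subst h
      have h1 : unityRoots F 1 = ⊥ := by
        ext a
        rw [mem_unityRoots, pow_one, Subgroup.mem_bot]
      simp only [Finset.prod_empty, Finset.card_empty, h1, bot_le, if_true]
      ring
    · rw [if_neg h, card_unityRoots_le_linearParts hp hq H hH]
      · push_cast
        ring
      · intro h1
        obtain ⟨e, he⟩ := Finset.nonempty_iff_ne_empty.2 h
        have h2 : e ∣ 1 := h1 ▸ Finset.dvd_prod_of_mem _ he
        exact (Nat.prime_of_mem_primeFactors (Finset.mem_powerset.1 hP he)).one_lt.ne'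
          (Nat.dvd_one.1 h2)
      · exact (Finset.prod_dvd_prod_of_subset _ _ _ (Finset.mem_powerset.1 hP)).trans
          (Nat.prod_primeFactors_dvd _)
  rw [stabCount_eq_sum_powerset, Finset.sum_congr rfl hterm, Finset.sum_add_distrib,
    Finset.sum_ite_eq', if_pos (Finset.empty_mem_powerset _), ← Finset.mul_sum]
  congr 2
  · rw [card_transStab_eq hp hq H hH (one_dvd _)]
    -- `ZMod 1` is trivial, so `p = 1` there.
    have h1 : multOrd 1 p = 1 := orderOf_eq_one_iff.2 (Subsingleton.elim _ _)
    simp only [h1, Nat.div_one, one_mul, mul_one, pow_one]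
  · refine Finset.sum_congr rfl fun P hP => ?_
    rw [card_transStab_eq hp hq H hH ((Finset.prod_dvd_prod_of_subset _ _ _
      (Finset.mem_powerset.1 hP)).trans (Nat.prod_primeFactors_dvd _)), Finset.mul_sum]
    refine Finset.sum_congr rfl fun l _ => ?_
    rw [pow_add]
    ring
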